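/- Let $\alpha,b_1,b_2\in\mathbb C$ with $\alpha\neq 0$, and for $b>0$ let \[ A_b=\begin{bmatrix} \alpha & 0 & \overline{b_1}+1 & 0 \\ 0 & \alpha & b & \overline{b_2}+1 \\ b_1-1 & b & -\alpha & 0 \\ 0 & b_2-1 & 0 & -\alpha \end{bmatrix}. \] For a matrix $A\in\mathbb C^{4\times 4}$ let $W(A)=\{\langle Ax,x\rangle : x\in\mathbb C^4,\ \|x\|=1\}$ be its numerical range. Call a subset of $\mathbb C$ bi-elliptical if it is the convex hull of two (non-degenerate) ellipses with distinct centers, neither of which is contained in the elliptical disk bounded by the other. Then there is at most one value $b>0$ for which $W(A_b)$ is bi-elliptical. -/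

import Mathlib

noncomputable section

/-- The numerical range `W(A) = {⟨Ax, x⟩ : ‖x‖ = 1}` of a square complex matrix, for the standard
inner product of `ℂⁿ`. (Mathlib's inner product is conjugate-linear in its first argument.) -/
def numericalRange {n : ℕ} (A : Matrix (Fin n) (Fin n) ℂ) : Set ℂ :=
  {z | ∃ x : EuclideanSpace ℂ (Fin n), ‖x‖ = 1 ∧ inner ℂ x (Matrix.toEuclideanLin A x) = z}

/-- The ellipse in `ℂ` with center `c`, semi-axes `r` and `s`, the first of them in the
direction `exp (i φ)`. -/
def ellipse (c : ℂ) (r s φ : ℝ) : Set ℂ :=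
  {z | ∃ t : ℝ, z = c + Complex.exp (φ * Complex.I) *
    ((r * Real.cos t : ℝ) + (s * Real.sin t : ℝ) * Complex.I)}

/-- `E` is a (non-degenerate) ellipse with center `c`; circles are included. -/
def IsEllipseWithCenter (E : Set ℂ) (c : ℂ) : Prop :=
  ∃ r s φ : ℝ, 0 < r ∧ 0 < s ∧ E = ellipse c r s φ

/-- `S` is bi-elliptical: the convex hull of two ellipses with distinct centers, neither of which
lies in the elliptical disk bounded by the other (otherwise `S` would be an elliptical disk). -/
def IsBiElliptical (S : Set ℂ) : Prop :=
  ∃ (E₁ E₂ : Set ℂ) (c₁ c₂ : ℂ), IsEllipseWithCenter E₁ c₁ ∧ IsEllipseWithCenter E₂ c₂ ∧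
    c₁ ≠ c₂ ∧ ¬ E₁ ⊆ convexHull ℝ E₂ ∧ ¬ E₂ ⊆ convexHull ℝ E₁ ∧
    S = convexHull ℝ (E₁ ∪ E₂)

/-- The matrix with blocks `α I`, `B* + I`, `B - I`, `-α I`, for the upper triangular matrix `B`
with diagonal `b₁, b₂` and real upper right entry `b`. -/
def triangularizedMatrix (α b₁ b₂ : ℂ) (b : ℝ) : Matrix (Fin 4) (Fin 4) ℂ :=
  !![α, 0, star b₁ + 1, 0;
     0, α, (b : ℂ), star b₂ + 1;
     b₁ - 1, (b : ℂ), -α, 0;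
     0, b₂ - 1, 0, -α]

end

open Filter Topology

/-! ### One-sided comparison of functions at a kink -/

theorem frequently_eq_right {f g : ℝ → ℝ} {f' g' : ℝ} (hf : HasDerivAt f f' 0)
    (hg : HasDerivAt g g' 0) (h : ∃ᶠ t in 𝓝[>] (0 : ℝ), f t = g t) : f 0 = g 0 ∧ f' = g' := by
  have h0 : f 0 = g 0 := by
    have hc : Tendsto (fun t => f t - g t) (𝓝[>] 0) (𝓝 (f 0 - g 0)) :=
      (hf.continuousAt.sub hg.continuousAt).tendsto.mono_left nhdsWithin_le_nhds
    by_contra hne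
    have := hc.eventually_ne (sub_ne_zero.2 hne)
    obtain ⟨t, ht, ht'⟩ := (h.and_eventually this).exists
    exact ht' (sub_eq_zero.2 ht)
  refine ⟨h0, ?_⟩
  have hd := (hasDerivAt_iff_tendsto_slope_zero.1 (hf.sub hg)).mono_left
    (nhdsWithin_mono (0 : ℝ) (fun t (ht : t ∈ Set.Ioi (0 : ℝ)) => ne_of_gt ht))
  by_contra hne
  have := hd.eventually_ne (sub_ne_zero.2 hne)
  obtain ⟨t, ht, ht'⟩ := (h.and_eventually this).exists
  apply ht'
  simp [ht, h0]

theorem frequently_eq_left {f g : ℝ → ℝ} {f' g' : ℝ} (hf : HasDerivAt f f' 0)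
    (hg : HasDerivAt g g' 0) (h : ∃ᶠ t in 𝓝[<] (0 : ℝ), f t = g t) : f 0 = g 0 ∧ f' = g' := by
  have hneg : Tendsto (fun t : ℝ => -t) (𝓝[<] 0) (𝓝[>] 0) := by
    simpa using tendsto_neg_nhdsLT (a := (0 : ℝ))
  have hf' : HasDerivAt (fun t => f (-t)) (-f') 0 := by
    have hf0 : HasDerivAt f f' (-0) := by simpa using hf
    simpa [Function.comp_def] using hf0.comp (0 : ℝ) (hasDerivAt_neg (0 : ℝ))
  have hg' : HasDerivAt (fun t => g (-t)) (-g') 0 := by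
    have hg0 : HasDerivAt g g' (-0) := by simpa using hg
    simpa [Function.comp_def] using hg0.comp (0 : ℝ) (hasDerivAt_neg (0 : ℝ))
  have := frequently_eq_right hf' hg' (hneg.frequently (by simpa using h))
  simpa using this

theorem eventually_lt_right {f g : ℝ → ℝ} {f' g' : ℝ} (hf : HasDerivAt f f' 0)
    (hg : HasDerivAt g g' 0) (h0 : f 0 = g 0) (h : f' < g') : ∀ᶠ t in 𝓝[>] (0 : ℝ), f t < g t := by
  have hd := (hasDerivAt_iff_tendsto_slope_zero.1 (hg.sub hf)).mono_left
    (nhdsWithin_mono (0 : ℝ) (fun t (ht : t ∈ Set.Ioi (0 : ℝ)) => ne_of_gt ht))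
  filter_upwards [hd.eventually_const_lt (sub_pos.2 h), self_mem_nhdsWithin] with t ht ht0
  have ht0' : (0 : ℝ) < t := ht0
  simp only [zero_add, Pi.sub_apply, h0, sub_self, sub_zero, smul_eq_mul] at ht
  have := (mul_pos_iff_of_pos_left (inv_pos.2 ht0')).1 ht
  linarith

theorem eventually_lt_left {f g : ℝ → ℝ} {f' g' : ℝ} (hf : HasDerivAt f f' 0)
    (hg : HasDerivAt g g' 0) (h0 : f 0 = g 0) (h : f' < g') : ∀ᶠ t in 𝓝[<] (0 : ℝ), g t < f t := by
  have hd := (hasDerivAt_iff_tendsto_slope_zero.1 (hg.sub hf)).mono_left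
    (nhdsWithin_mono (0 : ℝ) (fun t (ht : t ∈ Set.Iio (0 : ℝ)) => ne_of_lt ht))
  filter_upwards [hd.eventually_const_lt (sub_pos.2 h), self_mem_nhdsWithin] with t ht ht0
  have ht0' : t < 0 := ht0
  simp only [zero_add, Pi.sub_apply, h0, sub_self, sub_zero, smul_eq_mul] at ht
  have := inv_lt_zero.2 ht0'
  nlinarith

/-- If the maximum of two differentiable functions has a kink at `0`, each of the two functions
is the maximum on one side of `0`. -/
theorem branches_of_max_kink {u₁ u₂ wr wl : ℝ → ℝ} {u₁' u₂' wr' wl' : ℝ}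
    (h₁ : HasDerivAt u₁ u₁' 0) (h₂ : HasDerivAt u₂ u₂' 0) (hr : HasDerivAt wr wr' 0)
    (hl : HasDerivAt wl wl' 0) (hlt : wl' < wr')
    (er : ∀ᶠ t in 𝓝[>] (0 : ℝ), max (u₁ t) (u₂ t) = wr t)
    (el : ∀ᶠ t in 𝓝[<] (0 : ℝ), max (u₁ t) (u₂ t) = wl t) :
    u₁ 0 = u₂ 0 ∧
    (((∀ᶠ t in 𝓝[>] (0 : ℝ), u₁ t = wr t) ∧ (∀ᶠ t in 𝓝[<] (0 : ℝ), u₂ t = wl t)) ∨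
     ((∀ᶠ t in 𝓝[>] (0 : ℝ), u₂ t = wr t) ∧ (∀ᶠ t in 𝓝[<] (0 : ℝ), u₁ t = wl t))) := by
  -- By pigeonhole, some branch attains the maximum frequently on each side. That already fixes its
  -- value and derivative at `0`.
  have hR : (∃ᶠ t in 𝓝[>] (0 : ℝ), u₁ t = wr t) ∨ (∃ᶠ t in 𝓝[>] (0 : ℝ), u₂ t = wr t) := by
    rw [← frequently_or_distrib]
    refine (er.mono fun t ht => ?_).frequently
    rcases max_choice (u₁ t) (u₂ t) with h | h
    · exact Or.inl (h ▸ ht)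
    · exact Or.inr (h ▸ ht)
  have hL : (∃ᶠ t in 𝓝[<] (0 : ℝ), u₁ t = wl t) ∨ (∃ᶠ t in 𝓝[<] (0 : ℝ), u₂ t = wl t) := by
    rw [← frequently_or_distrib]
    refine (el.mono fun t ht => ?_).frequently
    rcases max_choice (u₁ t) (u₂ t) with h | h
    · exact Or.inl (h ▸ ht)
    · exact Or.inr (h ▸ ht)
  -- The two branches cross at `0` with different slopes, so "frequently" improves to "eventually".
  have key : ∀ {f g : ℝ → ℝ} {f' g' : ℝ}, HasDerivAt f f' 0 → HasDerivAt g g' 0 →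
      (∀ᶠ t in 𝓝[>] (0 : ℝ), max (f t) (g t) = wr t) →
      (∀ᶠ t in 𝓝[<] (0 : ℝ), max (f t) (g t) = wl t) → f 0 = g 0 → f' = wr' → g' = wl' →
      ((∀ᶠ t in 𝓝[>] (0 : ℝ), f t = wr t) ∧ (∀ᶠ t in 𝓝[<] (0 : ℝ), g t = wl t)) := by
    intro f g f' g' hf hg er el h0 e1 e2
    have hgf : g' < f' := by rw [e1, e2]; exact hlt
    constructor
    · filter_upwards [er, eventually_lt_right hg hf h0.symm hgf] with t ht ht'
      rwa [max_eq_left ht'.le] at ht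
    · filter_upwards [el, eventually_lt_left hg hf h0.symm hgf] with t ht ht'
      rwa [max_eq_right ht'.le] at ht
  have hw : wr 0 = wl 0 := by
    have c1 : Tendsto (fun t => max (u₁ t) (u₂ t)) (𝓝 0) (𝓝 (max (u₁ 0) (u₂ 0))) :=
      (h₁.continuousAt.tendsto.max h₂.continuousAt.tendsto)
    have a1 := tendsto_nhds_unique ((c1.mono_left nhdsWithin_le_nhds).congr' er)
      (hr.continuousAt.tendsto.mono_left nhdsWithin_le_nhds)
    have a2 := tendsto_nhds_unique ((c1.mono_left nhdsWithin_le_nhds).congr' el)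
      (hl.continuousAt.tendsto.mono_left nhdsWithin_le_nhds)
    rw [← a1, ← a2]
  rcases hR with hR | hR <;> rcases hL with hL | hL
  · have a := frequently_eq_right h₁ hr hR
    have b := frequently_eq_left h₁ hl hL
    exact absurd (a.2.symm.trans b.2) hlt.ne'
  · have a := frequently_eq_right h₁ hr hR
    have b := frequently_eq_left h₂ hl hL
    have h0 : u₁ 0 = u₂ 0 := by rw [a.1, b.1, hw]
    exact ⟨h0, Or.inl (key h₁ h₂ er el h0 a.2 b.2)⟩
  · have a := frequently_eq_right h₂ hr hR
    have b := frequently_eq_left h₁ hl hL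
    have h0 : u₁ 0 = u₂ 0 := by rw [a.1, b.1, hw]
    refine ⟨h0, Or.inr (key h₂ h₁ ?_ ?_ h0.symm a.2 b.2)⟩
    · simpa only [max_comm] using er
    · simpa only [max_comm] using el
  · have a := frequently_eq_right h₂ hr hR
    have b := frequently_eq_left h₂ hl hL
    exact absurd (a.2.symm.trans b.2) hlt.ne'

theorem hasDerivAt_quadratic_zero (a b c : ℝ) :
    HasDerivAt (fun t : ℝ => a + b * t + c * t ^ 2) b 0 := by
  have := (((hasDerivAt_id (0 : ℝ)).const_mul b).const_add a).add
    (((hasDerivAt_id (0 : ℝ)).pow 2).const_mul c)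
  simpa [Pi.add_def] using this

theorem quadratic_eq_zero {a b c : ℝ} (h : ∀ᶠ t in 𝓝[>] (0 : ℝ), a + b * t + c * t ^ 2 = 0) :
    a = 0 ∧ b = 0 ∧ c = 0 := by
  have := frequently_eq_right (hasDerivAt_quadratic_zero a b c) (hasDerivAt_const (0 : ℝ) (0 : ℝ))
    h.frequently
  obtain ⟨ha, hb⟩ := this
  have ha : a = 0 := by simpa using ha
  refine ⟨ha, hb, ?_⟩
  obtain ⟨t, ht, ht0⟩ := (h.and self_mem_nhdsWithin).exists
  have ht0 : (0 : ℝ) < t := ht0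
  rw [ha, hb] at ht
  have : c * t ^ 2 = 0 := by linarith
  simpa [ht0.ne'] using this

theorem hasDerivAt_sqrt_quadratic_zero {a : ℝ} (b c : ℝ) (ha : 0 < a) :
    HasDerivAt (fun t : ℝ => √(a + b * t + c * t ^ 2)) (b / (2 * √a)) 0 := by
  have := (hasDerivAt_quadratic_zero a b c).sqrt (by simpa using ha.ne')
  simpa using this

/-! ### Matching the coefficients of the two support functions -/

theorem coefficients_of_branches {p₁ q₁ p₂ q₂ r₁ s₁ u₁ r₂ s₂ u₂ e₀ e₁ e₂ k₀ k₁ k₂ : ℝ}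
    (hL : ¬ (p₁ = p₂ ∧ q₁ = q₂)) (hR₁ : 0 < r₁) (hR₂ : 0 < r₂) (hQ : 0 < k₀)
    {wr wl : ℝ → ℝ} {wr' wl' : ℝ} (hr : HasDerivAt wr wr' 0) (hl : HasDerivAt wl wl' 0)
    (hlt : wl' < wr')
    (sqr : ∀ᶠ t in 𝓝[>] (0 : ℝ), wr t ^ 2 = e₀ + e₁ * t + e₂ * t ^ 2 +
      t * √(k₀ + k₁ * t + k₂ * t ^ 2))
    (sql : ∀ᶠ t in 𝓝[<] (0 : ℝ), wl t ^ 2 = e₀ + e₁ * t + e₂ * t ^ 2 -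
      t * √(k₀ + k₁ * t + k₂ * t ^ 2))
    (h₀ : q₁ + √r₁ = q₂ + √r₂)
    (hp₁ : ∀ᶠ t in 𝓝[>] (0 : ℝ), q₁ + p₁ * t + √(r₁ + s₁ * t + u₁ * t ^ 2) = wr t)
    (hp₂ : ∀ᶠ t in 𝓝[<] (0 : ℝ), q₂ + p₂ * t + √(r₂ + s₂ * t + u₂ * t ^ 2) = wl t)
    (hmr : ∀ᶠ t in 𝓝[>] (0 : ℝ), max (-(q₁ + p₁ * t) + √(r₁ + s₁ * t + u₁ * t ^ 2))
        (-(q₂ + p₂ * t) + √(r₂ + s₂ * t + u₂ * t ^ 2)) = wr t)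
    (hml : ∀ᶠ t in 𝓝[<] (0 : ℝ), max (-(q₁ + p₁ * t) + √(r₁ + s₁ * t + u₁ * t ^ 2))
        (-(q₂ + p₂ * t) + √(r₂ + s₂ * t + u₂ * t ^ 2)) = wl t) :
    ∃ κ : ℝ, 0 < κ ∧ 4 * κ * e₀ = k₀ ∧ 4 * κ * e₁ = k₁ ∧ 4 * κ * e₂ = 4 * κ ^ 2 + k₂ := by
  have lin : ∀ p q : ℝ, HasDerivAt (fun t : ℝ => q + p * t) p 0 := fun p q => by
    simpa using hasDerivAt_quadratic_zero q p 0
  have d₁ := hasDerivAt_sqrt_quadratic_zero s₁ u₁ hR₁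
  have d₂ := hasDerivAt_sqrt_quadratic_zero s₂ u₂ hR₂
  have pos : ∀ {a : ℝ} (b c : ℝ), 0 < a → ∀ᶠ t in 𝓝 (0 : ℝ), 0 < a + b * t + c * t ^ 2 :=
    fun {a} b c ha => (hasDerivAt_quadratic_zero a b c).continuousAt.eventually_const_lt
      (by simpa using ha)
  have posr : ∀ {a : ℝ} (b c : ℝ), 0 < a → ∀ᶠ t in 𝓝[>] (0 : ℝ), 0 < a + b * t + c * t ^ 2 :=
    fun b c ha => (pos b c ha).filter_mono nhdsWithin_le_nhds
  rcases (branches_of_max_kink ((lin p₁ q₁).neg.add d₁) ((lin p₂ q₂).neg.add d₂) hr hl hlt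
    hmr hml).2 with ⟨a, b⟩ | ⟨a, b⟩
  -- If opposite directions use the same branch on each side, then `Lᵢ = -Lᵢ` there, so both `Lᵢ`
  -- vanish.
  · simp only [Pi.add_apply, Pi.neg_apply] at a b
    have z1 := frequently_eq_right (lin p₁ q₁) (hasDerivAt_const (0 : ℝ) (0 : ℝ)) (by
      refine Eventually.frequently ?_
      filter_upwards [hp₁, a] with t h1 h2
      linarith)
    have z2 := frequently_eq_left (lin p₂ q₂) (hasDerivAt_const (0 : ℝ) (0 : ℝ)) (by
      refine Eventually.frequently ?_
      filter_upwards [hp₂, b] with t h1 h2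
      linarith)
    simp only [mul_zero, add_zero] at z1 z2
    exact absurd ⟨z1.2.trans z2.2.symm, z1.1.trans z2.1.symm⟩ hL
  -- The branches swap: `L₁ + L₂` is `√R₂ - √R₁` on the right and its negative on the left. Equating
  -- values and slopes at `0` gives `L₁ + L₂ = 0`.
  · simp only [Pi.add_apply, Pi.neg_apply] at a b
    have ll := (lin p₁ q₁).add (lin p₂ q₂)
    have z1 := frequently_eq_right ll (d₂.sub d₁) (by
      refine Eventually.frequently ?_
      filter_upwards [hp₁, a] with t h1 h2
      simp only [Pi.add_apply, Pi.sub_apply]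
      linarith)
    have z2 := frequently_eq_left ll (d₁.sub d₂) (by
      refine Eventually.frequently ?_
      filter_upwards [hp₂, b] with t h1 h2
      simp only [Pi.add_apply, Pi.sub_apply]
      linarith)
    simp only [Pi.add_apply, Pi.sub_apply, mul_zero, add_zero, ne_eq, OfNat.ofNat_ne_zero,
      not_false_eq_true, zero_pow] at z1 z2
    have hq₁ : q₁ = 0 := by linarith [z1.1, z2.1]
    have hq₂ : q₂ = 0 := by linarith [z1.1, z2.1]
    have hp : p₂ = -p₁ := by linarith [z1.2, z2.2]
    subst hq₁ hq₂ hp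
    have hp0 : p₁ ≠ 0 := fun h => hL ⟨by rw [h]; simp, rfl⟩
    obtain ⟨e1, e2, e3⟩ := quadratic_eq_zero (a := r₁ - r₂) (b := s₁ - s₂) (c := u₁ - u₂) (by
      filter_upwards [hp₁, a, posr s₁ u₁ hR₁, posr s₂ u₂ hR₂] with t h1 h2 h3 h4
      have : √(r₁ + s₁ * t + u₁ * t ^ 2) = √(r₂ + s₂ * t + u₂ * t ^ 2) := by linarith
      have := (Real.sqrt_inj h3.le h4.le).1 this
      linarith)
    obtain rfl := sub_eq_zero.1 e1
    obtain rfl := sub_eq_zero.1 e2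
    obtain rfl := sub_eq_zero.1 e3
    have dF := (hasDerivAt_sqrt_quadratic_zero k₁ k₂ hQ).sub (d₁.const_mul (2 * p₁))
    have dtF := (hasDerivAt_id (0 : ℝ)).mul dF
    have dP := hasDerivAt_quadratic_zero (r₁ - e₀) (s₁ - e₁) (p₁ ^ 2 + u₁ - e₂)
    -- Let `P = R₁ + p₁² t² - E` and `F = √Q - 2 p₁ √R₁`. Then `P = t F` on the right and `P = -t F`
    -- on the left. Comparing values and slopes kills the two lowest coefficients of `P`; dividing
    -- by `t` and repeating kills the last, and then `F = 0`.
    have fr : ∀ᶠ t in 𝓝[>] (0 : ℝ), (r₁ - e₀) + (s₁ - e₁) * t + (p₁ ^ 2 + u₁ - e₂) * t ^ 2 =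
        t * (√(k₀ + k₁ * t + k₂ * t ^ 2) - 2 * p₁ * √(r₁ + s₁ * t + u₁ * t ^ 2)) := by
      filter_upwards [hp₁, sqr, posr s₁ u₁ hR₁] with t h1 h2 h3
      rw [← h1] at h2
      have := Real.sq_sqrt h3.le
      linear_combination h2 - this
    have fl : ∀ᶠ t in 𝓝[<] (0 : ℝ), (r₁ - e₀) + (s₁ - e₁) * t + (p₁ ^ 2 + u₁ - e₂) * t ^ 2 =
        -(t * (√(k₀ + k₁ * t + k₂ * t ^ 2) - 2 * p₁ * √(r₁ + s₁ * t + u₁ * t ^ 2))) := by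
      filter_upwards [hp₂, sql, (pos s₁ u₁ hR₁).filter_mono nhdsWithin_le_nhds] with t h1 h2 h3
      rw [← h1] at h2
      have := Real.sq_sqrt h3.le
      linear_combination h2 - this
    have y1 := frequently_eq_right dP dtF fr.frequently
    have y2 := frequently_eq_left dP dtF.neg fl.frequently
    have v0 : r₁ - e₀ = 0 := by simpa using y1.1
    have v1 : s₁ - e₁ = 0 := by linarith [y1.2, y2.2]
    have lm := lin (p₁ ^ 2 + u₁ - e₂) 0
    have x1 := frequently_eq_right lm dF (by
      refine Eventually.frequently ?_
      filter_upwards [fr, self_mem_nhdsWithin] with t ht ht0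
      have ht0 : (0 : ℝ) < t := ht0
      refine mul_left_cancel₀ ht0.ne' ?_
      simp only [Pi.sub_apply]
      rw [← ht, v0, v1]; ring)
    have x2 := frequently_eq_left lm dF.neg (by
      refine Eventually.frequently ?_
      filter_upwards [fl, self_mem_nhdsWithin] with t ht ht0
      have ht0 : t < 0 := ht0
      refine mul_left_cancel₀ ht0.ne ?_
      simp only [Pi.sub_apply, Pi.neg_apply, mul_neg]
      rw [← ht, v0, v1]; ring)
    have v2 : p₁ ^ 2 + u₁ - e₂ = 0 := by linarith [x1.2, x2.2]
    obtain ⟨g0, g1, g2⟩ := quadratic_eq_zero (a := k₀ - 4 * p₁ ^ 2 * r₁)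
      (b := k₁ - 4 * p₁ ^ 2 * s₁) (c := k₂ - 4 * p₁ ^ 2 * u₁) (by
      filter_upwards [fr, self_mem_nhdsWithin, posr s₁ u₁ hR₁, posr k₁ k₂ hQ] with t ht ht0 h3 h4
      have ht0 : (0 : ℝ) < t := ht0
      rw [v0, v1, v2] at ht
      have ht : t * (√(k₀ + k₁ * t + k₂ * t ^ 2) - 2 * p₁ * √(r₁ + s₁ * t + u₁ * t ^ 2)) = 0 := by
        linarith
      have hF := (mul_eq_zero.1 ht).resolve_left ht0.ne'
      have h3' := Real.sq_sqrt h3.le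
      have h4' := Real.sq_sqrt h4.le
      linear_combination (√(k₀ + k₁ * t + k₂ * t ^ 2) + 2 * p₁ * √(r₁ + s₁ * t + u₁ * t ^ 2)) * hF
        - h4' + 4 * p₁ ^ 2 * h3')
    refine ⟨p₁ ^ 2, by positivity, ?_, ?_, ?_⟩
    · linear_combination -4 * p₁ ^ 2 * v0 - g0
    · linear_combination -4 * p₁ ^ 2 * v1 - g1
    · linear_combination -4 * p₁ ^ 2 * v2 - g2

/-- The comparison of two expressions for a support function with a kink: if
`max (L₁ + √R₁) (L₂ + √R₂)` and `max (-L₁ + √R₁) (-L₂ + √R₂)` both equal `√(E + |t| √Q)` near `0`,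
for affine `L₁ ≠ L₂` and quadratic `R₁, R₂, E, Q` positive at `0`, then `E = κ t² + Q / (4 κ)`. -/
theorem coefficients_of_kink {p₁ q₁ p₂ q₂ r₁ s₁ u₁ r₂ s₂ u₂ e₀ e₁ e₂ k₀ k₁ k₂ : ℝ}
    (hL : ¬ (p₁ = p₂ ∧ q₁ = q₂)) (hR₁ : 0 < r₁) (hR₂ : 0 < r₂) (hE : 0 < e₀) (hQ : 0 < k₀)
    (hp : ∀ᶠ t in 𝓝[≠] (0 : ℝ), max (q₁ + p₁ * t + √(r₁ + s₁ * t + u₁ * t ^ 2))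
        (q₂ + p₂ * t + √(r₂ + s₂ * t + u₂ * t ^ 2)) =
      √(e₀ + e₁ * t + e₂ * t ^ 2 + |t| * √(k₀ + k₁ * t + k₂ * t ^ 2)))
    (hm : ∀ᶠ t in 𝓝[≠] (0 : ℝ), max (-(q₁ + p₁ * t) + √(r₁ + s₁ * t + u₁ * t ^ 2))
        (-(q₂ + p₂ * t) + √(r₂ + s₂ * t + u₂ * t ^ 2)) =
      √(e₀ + e₁ * t + e₂ * t ^ 2 + |t| * √(k₀ + k₁ * t + k₂ * t ^ 2))) :
    ∃ κ : ℝ, 0 < κ ∧ 4 * κ * e₀ = k₀ ∧ 4 * κ * e₁ = k₁ ∧ 4 * κ * e₂ = 4 * κ ^ 2 + k₂ := by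
  have dQ := hasDerivAt_sqrt_quadratic_zero k₁ k₂ hQ
  have dtQ := (hasDerivAt_id (0 : ℝ)).mul dQ
  have dE := hasDerivAt_quadratic_zero e₀ e₁ e₂
  have dr := dE.add dtQ
  have dl := dE.sub dtQ
  have wr := dr.sqrt (by simpa using hE.ne')
  have wl := dl.sqrt (by simpa using hE.ne')
  -- The one-sided slopes are `(e₁ ∓ √k₀) / (2 √e₀)`.
  have hlt : (e₁ - (1 * √(k₀ + k₁ * 0 + k₂ * 0 ^ 2) + id 0 * (k₁ / (2 * √k₀)))) /
      (2 * √(e₀ + e₁ * 0 + e₂ * 0 ^ 2 - id 0 * √(k₀ + k₁ * 0 + k₂ * 0 ^ 2))) <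
      (e₁ + (1 * √(k₀ + k₁ * 0 + k₂ * 0 ^ 2) + id 0 * (k₁ / (2 * √k₀)))) /
      (2 * √(e₀ + e₁ * 0 + e₂ * 0 ^ 2 + id 0 * √(k₀ + k₁ * 0 + k₂ * 0 ^ 2))) := by
    have h1 := Real.sqrt_pos.2 hE
    have h2 := Real.sqrt_pos.2 hQ
    simp only [mul_zero, add_zero, one_mul, id_eq, zero_mul, sub_zero, ne_eq, OfNat.ofNat_ne_zero,
      not_false_eq_true, zero_pow]
    exact div_lt_div_of_pos_right (by linarith) (by linarith)
  have er : ∀ᶠ t in 𝓝[>] (0 : ℝ), √(e₀ + e₁ * t + e₂ * t ^ 2 + |t| * √(k₀ + k₁ * t + k₂ * t ^ 2)) =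
      √(e₀ + e₁ * t + e₂ * t ^ 2 + id t * √(k₀ + k₁ * t + k₂ * t ^ 2)) := by
    filter_upwards [self_mem_nhdsWithin] with t ht
    rw [abs_of_pos ht, id]
  have el : ∀ᶠ t in 𝓝[<] (0 : ℝ), √(e₀ + e₁ * t + e₂ * t ^ 2 + |t| * √(k₀ + k₁ * t + k₂ * t ^ 2)) =
      √(e₀ + e₁ * t + e₂ * t ^ 2 - id t * √(k₀ + k₁ * t + k₂ * t ^ 2)) := by
    filter_upwards [self_mem_nhdsWithin] with t ht
    rw [abs_of_neg ht, id, neg_mul, ← sub_eq_add_neg]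
  have toR : 𝓝[>] (0 : ℝ) ≤ 𝓝[≠] 0 := nhdsWithin_mono _ fun t (ht : 0 < t) => ht.ne'
  have toL : 𝓝[<] (0 : ℝ) ≤ 𝓝[≠] 0 := nhdsWithin_mono _ fun t (ht : t < 0) => ht.ne
  have hpr := ((hp.filter_mono toR).and er).mono fun t h => h.1.trans h.2
  have hpl := ((hp.filter_mono toL).and el).mono fun t h => h.1.trans h.2
  have hmr := ((hm.filter_mono toR).and er).mono fun t h => h.1.trans h.2
  have hml := ((hm.filter_mono toL).and el).mono fun t h => h.1.trans h.2
  have posr : ∀ᶠ t in 𝓝 (0 : ℝ), 0 < e₀ + e₁ * t + e₂ * t ^ 2 +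
      id t * √(k₀ + k₁ * t + k₂ * t ^ 2) :=
    dr.continuousAt.eventually_const_lt (by simpa using hE)
  have posl : ∀ᶠ t in 𝓝 (0 : ℝ), 0 < e₀ + e₁ * t + e₂ * t ^ 2 -
      id t * √(k₀ + k₁ * t + k₂ * t ^ 2) :=
    dl.continuousAt.eventually_const_lt (by simpa using hE)
  have sqr := (posr.filter_mono (nhdsWithin_le_nhds (s := Set.Ioi 0))).mono
    fun t h => Real.sq_sqrt h.le
  have sql := (posl.filter_mono (nhdsWithin_le_nhds (s := Set.Iio 0))).mono
    fun t h => Real.sq_sqrt h.le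
  have lin : ∀ p q : ℝ, HasDerivAt (fun t : ℝ => q + p * t) p 0 := fun p q => by
    simpa using hasDerivAt_quadratic_zero q p 0
  obtain ⟨h0, ⟨a, b⟩ | ⟨a, b⟩⟩ := branches_of_max_kink
    ((lin p₁ q₁).add (hasDerivAt_sqrt_quadratic_zero s₁ u₁ hR₁))
    ((lin p₂ q₂).add (hasDerivAt_sqrt_quadratic_zero s₂ u₂ hR₂)) wr wl hlt hpr hpl
  · exact coefficients_of_branches hL hR₁ hR₂ hQ wr wl hlt sqr sql (by simpa using h0)
      a b hmr hml
  · refine coefficients_of_branches (fun h => hL ⟨h.1.symm, h.2.symm⟩) hR₂ hR₁ hQ wr wl hlt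
      sqr sql (by simpa using h0.symm) a b ?_ ?_
    · exact hmr.mono fun t h => (max_comm _ _).trans h
    · exact hml.mono fun t h => (max_comm _ _).trans h

/-! ### Elimination in the coefficient equations -/

/-- Uniqueness of the off-diagonal entry from the matching of coefficients. -/
theorem sq_unique {a₁ a₂ x₁ y₁ x₂ y₂ β β' m m' : ℝ} (ha : ¬ (a₁ = 0 ∧ a₂ = 0))
    (hβ : 0 < β) (hβ' : 0 < β') (hm : 0 < m) (hm' : 0 < m')
    (h0 : m * (a₂ ^ 2 + 1) = (y₁ - y₂) ^ 2 + β)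
    (h1 : m * (2 * a₁ * a₂ + (y₁ + y₂)) =
      (x₁ ^ 2 + y₁ ^ 2 - (x₂ ^ 2 + y₂ ^ 2) + β) * (y₁ - y₂) + 2 * β * y₂)
    (h2 : 4 * m * (a₁ ^ 2 + (x₁ ^ 2 + y₁ ^ 2 + (x₂ ^ 2 + y₂ ^ 2) + β) / 2) =
      m ^ 2 + ((x₁ ^ 2 + y₁ ^ 2 - (x₂ ^ 2 + y₂ ^ 2) + β) ^ 2 + 4 * β * (x₂ ^ 2 + y₂ ^ 2)))
    (h0' : m' * (a₂ ^ 2 + 1) = (y₁ - y₂) ^ 2 + β')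
    (h1' : m' * (2 * a₁ * a₂ + (y₁ + y₂)) =
      (x₁ ^ 2 + y₁ ^ 2 - (x₂ ^ 2 + y₂ ^ 2) + β') * (y₁ - y₂) + 2 * β' * y₂)
    (h2' : 4 * m' * (a₁ ^ 2 + (x₁ ^ 2 + y₁ ^ 2 + (x₂ ^ 2 + y₂ ^ 2) + β') / 2) =
      m' ^ 2 + ((x₁ ^ 2 + y₁ ^ 2 - (x₂ ^ 2 + y₂ ^ 2) + β') ^ 2 + 4 * β' * (x₂ ^ 2 + y₂ ^ 2))) :
    β = β' := by
  have hd : (a₂ ^ 2 + 1) * (m - m') = β - β' := by linear_combination h0 - h0'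
  suffices hmm : m = m' by rw [hmm] at hd; linarith
  have hs : (m - m') * (a₂ * (2 * a₁ - a₂ * (y₁ + y₂))) = 0 := by
    linear_combination h1 - h1' - (y₁ + y₂) * (h0 - h0')
  rcases mul_eq_zero.1 hs with h | h
  · linarith
  rcases mul_eq_zero.1 h with h | h
  · subst h
    have ha₁ : a₁ ≠ 0 := fun h => ha ⟨h, rfl⟩
    have e : β = m - (y₁ - y₂) ^ 2 := by linarith
    have e' : β' = m' - (y₁ - y₂) ^ 2 := by linarith
    subst e e'
    have : a₁ ^ 2 * (m - m') = 0 := by linear_combination (h2 - h2') / 4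
    have := (mul_eq_zero.1 this).resolve_left (pow_ne_zero 2 ha₁)
    linarith
  · by_cases hz : a₂ = 0
    · exact absurd ⟨by rw [hz] at h; linarith, hz⟩ ha
    have e : β = m * (a₂ ^ 2 + 1) - (y₁ - y₂) ^ 2 := by linarith
    have e' : β' = m' * (a₂ ^ 2 + 1) - (y₁ - y₂) ^ 2 := by linarith
    have ea : a₁ = a₂ * (y₁ + y₂) / 2 := by linarith
    subst e e' ea
    have hA : 0 < a₂ ^ 2 := by positivity
    -- With `β` and `a₁` eliminated, `m` cancels from `h1`.
    have hq : (y₁ - y₂) * ((y₁ - y₂) * (y₁ + y₂) - (x₁ ^ 2 + y₁ ^ 2 - (x₂ ^ 2 + y₂ ^ 2))) = 0 := by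
      linear_combination h1
    -- What is left of `h2` is a quadratic in `T = a₂² n - (y₁ - y₂)²`.
    have root : ∀ n : ℝ, 4 * n * ((a₂ * (y₁ + y₂) / 2) ^ 2 + (x₁ ^ 2 + y₁ ^ 2 + (x₂ ^ 2 + y₂ ^ 2) +
          (n * (a₂ ^ 2 + 1) - (y₁ - y₂) ^ 2)) / 2) =
        n ^ 2 + ((x₁ ^ 2 + y₁ ^ 2 - (x₂ ^ 2 + y₂ ^ 2) + (n * (a₂ ^ 2 + 1) - (y₁ - y₂) ^ 2)) ^ 2 +
          4 * (n * (a₂ ^ 2 + 1) - (y₁ - y₂) ^ 2) * (x₂ ^ 2 + y₂ ^ 2)) →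
        (a₂ ^ 2 * n - (y₁ - y₂) ^ 2) ^ 2 +
          (2 * x₁ ^ 2 + 2 * x₂ ^ 2 + (y₁ - y₂) ^ 2) * (a₂ ^ 2 * n - (y₁ - y₂) ^ 2) +
          (x₁ ^ 2 + y₁ ^ 2 - (x₂ ^ 2 + y₂ ^ 2)) ^ 2 - (y₁ - y₂) ^ 2 * (y₁ + y₂) ^ 2 = 0 := by
      intro n hn
      linear_combination -hn
    have r := root m h2
    rcases mul_eq_zero.1 hq with hq | hq
    -- If `y₁ = y₂`, then `T = a₂² m > 0` and the quadratic is a sum of nonnegative terms containing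
    -- `T²`.
    · rw [hq] at r
      have : 0 < a₂ ^ 2 * m := by positivity
      exfalso
      nlinarith [sq_nonneg x₁, sq_nonneg x₂, mul_pos this this,
        sq_nonneg (x₁ ^ 2 + y₁ ^ 2 - (x₂ ^ 2 + y₂ ^ 2)), mul_nonneg this.le (sq_nonneg x₁), mul_nonneg this.le (sq_nonneg x₂)]
    -- Here the constant term vanishes and the cofactor of `T` is positive, so `T = 0`, which
    -- determines `n`.
    · have root' : ∀ n : ℝ, 0 < n → (a₂ ^ 2 * n - (y₁ - y₂) ^ 2) ^ 2 +
          (2 * x₁ ^ 2 + 2 * x₂ ^ 2 + (y₁ - y₂) ^ 2) * (a₂ ^ 2 * n - (y₁ - y₂) ^ 2) +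
          (x₁ ^ 2 + y₁ ^ 2 - (x₂ ^ 2 + y₂ ^ 2)) ^ 2 - (y₁ - y₂) ^ 2 * (y₁ + y₂) ^ 2 = 0 →
          a₂ ^ 2 * n = (y₁ - y₂) ^ 2 := by
        intro n hn hr
        have : (a₂ ^ 2 * n - (y₁ - y₂) ^ 2) * (a₂ ^ 2 * n + 2 * x₁ ^ 2 + 2 * x₂ ^ 2) = 0 := by
          linear_combination hr + ((y₁ - y₂) * (y₁ + y₂) + (x₁ ^ 2 + y₁ ^ 2 - (x₂ ^ 2 + y₂ ^ 2))) * hq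
        have hpos : 0 < a₂ ^ 2 * n + 2 * x₁ ^ 2 + 2 * x₂ ^ 2 := by positivity
        linarith [(mul_eq_zero.1 this).resolve_right hpos.ne']
      have := root' m hm r
      have := root' m' hm' (root m' h2')
      have : a₂ ^ 2 * (m - m') = 0 := by linarith
      linarith [(mul_eq_zero.1 this).resolve_left hA.ne']

/-! ### The support function of the numerical range -/

theorem numericalRange_image_isGreatest_of_quadratic {n : ℕ} {A : Matrix (Fin n) (Fin n) ℂ}
    {c s μ : ℝ}
    (hle : ∀ x : Fin n → ℂ, c * (star x ⬝ᵥ A.mulVec x).re + s * (star x ⬝ᵥ A.mulVec x).im ≤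
      μ * ∑ i, ‖x i‖ ^ 2)
    (hex : ∃ x : Fin n → ℂ, x ≠ 0 ∧
      c * (star x ⬝ᵥ A.mulVec x).re + s * (star x ⬝ᵥ A.mulVec x).im = μ * ∑ i, ‖x i‖ ^ 2) :
    IsGreatest ((fun z : ℂ => c * z.re + s * z.im) '' numericalRange A) μ := by
  have hin : ∀ x : EuclideanSpace ℂ (Fin n),
      inner ℂ x (Matrix.toEuclideanLin A x) = star x.ofLp ⬝ᵥ A.mulVec x.ofLp := by
    intro x
    rw [EuclideanSpace.inner_eq_star_dotProduct, dotProduct_comm]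
    rfl
  constructor
  · obtain ⟨x, hx0, hx⟩ := hex
    set y : EuclideanSpace ℂ (Fin n) := WithLp.toLp 2 x with hy
    have hy0 : y ≠ 0 := by
      intro h
      apply hx0
      simpa [hy] using h
    have hyn : ‖y‖ ≠ 0 := norm_ne_zero_iff.2 hy0
    refine ⟨_, ⟨((‖y‖⁻¹ : ℝ) : ℂ) • y, ?_, rfl⟩, ?_⟩
    · rw [norm_smul]
      simp [hyn]
    · simp only [map_smul, inner_smul_left, inner_smul_right, hin]
      have hn : ‖y‖ ^ 2 = ∑ i, ‖x i‖ ^ 2 := by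
        rw [EuclideanSpace.norm_sq_eq]
      have hyx : y.ofLp = x := rfl
      rw [hyx, Complex.conj_ofReal, Complex.re_ofReal_mul, Complex.re_ofReal_mul,
        Complex.im_ofReal_mul, Complex.im_ofReal_mul]
      rw [← hn] at hx
      field_simp
      linarith
  · rintro _ ⟨z, ⟨x, hx, rfl⟩, rfl⟩
    have := hle x.ofLp
    rw [← EuclideanSpace.norm_sq_eq, hx] at this
    simpa [hin] using this

/-- Cauchy–Schwarz for `(a, √l)` and `(Y - Z, 2G/√l)`, together with `(Y - Z)² + 4G²/l ≤ (Y + Z)²`.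
-/
theorem block_form_le {a Y Z G l : ℝ} (hY : 0 ≤ Y) (hZ : 0 ≤ Z) (hl : 0 < l)
    (hG : G ^ 2 ≤ l * (Y * Z)) : a * (Y - Z) + 2 * G ≤ √(a ^ 2 + l) * (Y + Z) := by
  refine le_of_abs_le <| abs_le_of_sq_le_sq ?_ (by positivity)
  rw [mul_pow, Real.sq_sqrt (by positivity)]
  have h : 0 ≤ l * ((a ^ 2 + l) * (Y + Z) ^ 2 - (a * (Y - Z) + 2 * G) ^ 2) := by
    have := mul_nonneg (add_nonneg hl.le (sq_nonneg a)) (sub_nonneg.2 hG)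
    nlinarith [sq_nonneg (2 * G * a - l * (Y - Z))]
  have := nonneg_of_mul_nonneg_right h hl
  linarith

open ComplexConjugate in
theorem triangularizedMatrix_form (α b₁ b₂ : ℂ) (b c s : ℝ) (x : Fin 4 → ℂ) :
    c * (star x ⬝ᵥ (triangularizedMatrix α b₁ b₂ b).mulVec x).re +
      s * (star x ⬝ᵥ (triangularizedMatrix α b₁ b₂ b).mulVec x).im =
    (c * α.re + s * α.im) * ((‖x 0‖ ^ 2 + ‖x 1‖ ^ 2) - (‖x 2‖ ^ 2 + ‖x 3‖ ^ 2)) +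
      2 * (conj (x 0) * ((c * conj b₁ - s * Complex.I) * x 2) +
        conj (x 1) * ((c * b : ℝ) * x 2 + (c * conj b₂ - s * Complex.I) * x 3)).re := by
  simp only [triangularizedMatrix, dotProduct, Matrix.mulVec, Fin.sum_univ_four, Complex.sq_norm,
    Complex.normSq_apply, Matrix.of_apply, Matrix.cons_val', Matrix.cons_val, Pi.star_apply,
    Complex.star_def]
  simp
  ring

theorem two_mul_le_add_of_sq_le {P Q g : ℝ} (hP : 0 ≤ P) (hQ : 0 ≤ Q) (h : g ^ 2 ≤ P * Q) :
    2 * g ≤ P + Q :=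
  le_of_abs_le <| abs_le_of_sq_le_sq (by nlinarith [sq_nonneg (P - Q)]) (by positivity)

-- For `M = [[m₁, 0], [β, m₂]]`, `hl` says that `l` is an eigenvalue of `M*M`, and `hl₁`, `hl₂`
-- select the larger one: `l - M*M` has nonnegative diagonal and zero determinant, so it is positive
-- semidefinite.
open ComplexConjugate in
theorem norm_sq_triangular_le {m₁ m₂ z₀ z₁ : ℂ} {β l : ℝ}
    (hl : (l - (‖m₁‖ ^ 2 + β ^ 2)) * (l - ‖m₂‖ ^ 2) = β ^ 2 * ‖m₂‖ ^ 2)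
    (hl₁ : ‖m₁‖ ^ 2 + β ^ 2 ≤ l) (hl₂ : ‖m₂‖ ^ 2 ≤ l) :
    ‖m₁ * z₀‖ ^ 2 + ‖β * z₀ + m₂ * z₁‖ ^ 2 ≤ l * (‖z₀‖ ^ 2 + ‖z₁‖ ^ 2) := by
  have e : ‖β * z₀ + m₂ * z₁‖ ^ 2 =
      β ^ 2 * ‖z₀‖ ^ 2 + ‖m₂‖ ^ 2 * ‖z₁‖ ^ 2 + 2 * (β * (conj z₀ * (m₂ * z₁)).re) := by
    simp only [Complex.sq_norm, Complex.normSq_apply]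
    simp
    ring
  have hg : (conj z₀ * (m₂ * z₁)).re ^ 2 ≤ ‖z₀‖ ^ 2 * (‖m₂‖ ^ 2 * ‖z₁‖ ^ 2) := by
    have := Complex.abs_re_le_norm (conj z₀ * (m₂ * z₁))
    rw [norm_mul, norm_mul, Complex.norm_conj] at this
    calc _ = |(conj z₀ * (m₂ * z₁)).re| ^ 2 := (sq_abs _).symm
      _ ≤ (‖z₀‖ * (‖m₂‖ * ‖z₁‖)) ^ 2 := by gcongr
      _ = _ := by ring
  have h2 := two_mul_le_add_of_sq_le
    (P := (l - (‖m₁‖ ^ 2 + β ^ 2)) * ‖z₀‖ ^ 2) (Q := (l - ‖m₂‖ ^ 2) * ‖z₁‖ ^ 2)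
    (g := β * (conj z₀ * (m₂ * z₁)).re)
    (mul_nonneg (sub_nonneg.2 hl₁) (sq_nonneg _)) (mul_nonneg (sub_nonneg.2 hl₂) (sq_nonneg _)) (by
      calc _ = β ^ 2 * (conj z₀ * (m₂ * z₁)).re ^ 2 := by ring
        _ ≤ β ^ 2 * (‖z₀‖ ^ 2 * (‖m₂‖ ^ 2 * ‖z₁‖ ^ 2)) := by gcongr
        _ = (β ^ 2 * ‖m₂‖ ^ 2) * (‖z₀‖ ^ 2 * ‖z₁‖ ^ 2) := by ring
        _ = _ := by rw [← hl]; ring)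
  rw [norm_mul, mul_pow, e]
  linarith

open ComplexConjugate in
theorem numericalRange_triangularizedMatrix_isGreatest (α b₁ b₂ : ℂ) (b c s l : ℝ) (hcb : c * b ≠ 0)
    (hm : c * conj b₂ - s * Complex.I ≠ 0)
    (hl : (l - (‖c * conj b₁ - s * Complex.I‖ ^ 2 + (c * b) ^ 2)) *
      (l - ‖c * conj b₂ - s * Complex.I‖ ^ 2) = (c * b) ^ 2 * ‖c * conj b₂ - s * Complex.I‖ ^ 2)
    (hl₁ : ‖c * conj b₁ - s * Complex.I‖ ^ 2 + (c * b) ^ 2 ≤ l)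
    (hl₂ : ‖c * conj b₂ - s * Complex.I‖ ^ 2 ≤ l) :
    IsGreatest ((fun z : ℂ => c * z.re + s * z.im) ''
      numericalRange (triangularizedMatrix α b₁ b₂ b))
      √((c * α.re + s * α.im) ^ 2 + l) := by
  have hl0 : 0 < l := lt_of_lt_of_le (by positivity) hl₂
  apply numericalRange_image_isGreatest_of_quadratic
  · intro x
    rw [triangularizedMatrix_form, Fin.sum_univ_four]
    generalize c * conj b₁ - s * Complex.I = m₁ at *
    generalize c * conj b₂ - s * Complex.I = m₂ at *
    have h := norm_sq_triangular_le (z₀ := x 2) (z₁ := x 3) hl hl₁ hl₂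
    have := block_form_le (a := c * α.re + s * α.im) (Y := ‖x 0‖ ^ 2 + ‖x 1‖ ^ 2)
      (Z := ‖x 2‖ ^ 2 + ‖x 3‖ ^ 2) (l := l) (G := (conj (x 0) * (m₁ * x 2) +
        conj (x 1) * ((c * b : ℝ) * x 2 + m₂ * x 3)).re) (by positivity) (by positivity) hl0 (by
        generalize m₁ * x 2 = w₀ at *
        generalize ((c * b : ℝ) : ℂ) * x 2 + m₂ * x 3 = w₁ at *
        have h1 : |(conj (x 0) * w₀ + conj (x 1) * w₁).re| ≤ ‖x 0‖ * ‖w₀‖ + ‖x 1‖ * ‖w₁‖ := by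
          refine (Complex.abs_re_le_norm _).trans ((norm_add_le _ _).trans ?_)
          rw [norm_mul, norm_mul, Complex.norm_conj, Complex.norm_conj]
        calc _ = |(conj (x 0) * w₀ + conj (x 1) * w₁).re| ^ 2 := (sq_abs _).symm
          _ ≤ (‖x 0‖ * ‖w₀‖ + ‖x 1‖ * ‖w₁‖) ^ 2 := by gcongr
          _ ≤ (‖x 0‖ ^ 2 + ‖x 1‖ ^ 2) * (‖w₀‖ ^ 2 + ‖w₁‖ ^ 2) := by
            nlinarith [sq_nonneg (‖x 0‖ * ‖w₁‖ - ‖x 1‖ * ‖w₀‖)]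
          _ ≤ (‖x 0‖ ^ 2 + ‖x 1‖ ^ 2) * (l * (‖x 2‖ ^ 2 + ‖x 3‖ ^ 2)) := by gcongr
          _ = _ := by ring)
    linarith
  · set a := c * α.re + s * α.im with ha
    have hμ : √(a ^ 2 + l) ^ 2 = a ^ 2 + l := Real.sq_sqrt (by positivity)
    have hμa : a < √(a ^ 2 + l) := Real.lt_sqrt_of_sq_lt (by linarith)
    set μ := √(a ^ 2 + l)
    simp only [triangularizedMatrix_form, Fin.sum_univ_four]
    rw [← ha]
    generalize c * conj b₁ - s * Complex.I = m₁ at *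
    generalize c * conj b₂ - s * Complex.I = m₂ at *
    generalize c * b = β at *
    set u := l - (‖m₁‖ ^ 2 + β ^ 2) with hu
    -- The vector is `(M v, (μ - a) v)`, where `v = (β m₂, u)` satisfies `M*M v = l v`. It is an
    -- eigenvector of the Hermitian block matrix for `μ`.
    refine ⟨![m₁ * (β * m₂), β * (β * m₂) + m₂ * u, (μ - a : ℝ) * (β * m₂), (μ - a : ℝ) * u],
      ?_, ?_⟩
    · intro h
      have := congrFun h 2
      have hμa' : ((μ - a : ℝ) : ℂ) ≠ 0 := by exact_mod_cast (sub_pos.2 hμa).ne'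
      have hβ' : (β : ℂ) ≠ 0 := by exact_mod_cast hcb
      exact mul_ne_zero hμa' (mul_ne_zero hβ' hm) this
    · have hW : ‖m₁ * (β * m₂)‖ ^ 2 + ‖β * (β * m₂) + m₂ * u‖ ^ 2 =
          l * (‖β * m₂‖ ^ 2 + ‖(u : ℂ)‖ ^ 2) := by
        have : β * (β * m₂) + m₂ * u = ((β ^ 2 + u : ℝ) : ℂ) * m₂ := by push_cast; ring
        rw [this]
        simp only [norm_mul, mul_pow, Complex.norm_real, Real.norm_eq_abs, sq_abs]
        have hm1 : ‖m₁‖ ^ 2 = l - u - β ^ 2 := by rw [hu]; ring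
        rw [hm1]
        linear_combination -u * hl
      have hG : (conj (m₁ * (β * m₂)) * (m₁ * ((μ - a : ℝ) * (β * m₂))) +
          conj (β * (β * m₂) + m₂ * u) * (β * ((μ - a : ℝ) * (β * m₂)) + m₂ * ((μ - a : ℝ) * u))).re =
          (μ - a) * (‖m₁ * (β * m₂)‖ ^ 2 + ‖β * (β * m₂) + m₂ * u‖ ^ 2) := by
        simp only [← Complex.normSq_eq_norm_sq]
        rw [← Complex.ofReal_re ((μ - a) * _)]
        congr 1
        push_cast
        simp only [Complex.normSq_eq_conj_mul_self]
        ring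
      simp only [Matrix.cons_val]
      rw [hG, hW]
      rw [norm_mul ((μ - a : ℝ) : ℂ), norm_mul ((μ - a : ℝ) : ℂ), mul_pow, mul_pow,
        Complex.norm_real (μ - a), Real.norm_eq_abs, sq_abs]
      linear_combination (‖β * m₂‖ ^ 2 + ‖(u : ℂ)‖ ^ 2) * (a - μ) * hμ

/-! ### Support functions of ellipses and of convex hulls -/

theorem isGreatest_image_ellipse (z₀ : ℂ) (r s φ c d : ℝ) :
    IsGreatest ((fun z : ℂ => c * z.re + d * z.im) '' ellipse z₀ r s φ)
      (c * z₀.re + d * z₀.im + √((r * (c * Real.cos φ + d * Real.sin φ)) ^ 2 +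
        (s * (d * Real.cos φ - c * Real.sin φ)) ^ 2)) := by
  set P := r * (c * Real.cos φ + d * Real.sin φ) with hP
  set Q := s * (d * Real.cos φ - c * Real.sin φ) with hQ
  have val : ∀ t : ℝ, c * (z₀ + Complex.exp (φ * Complex.I) *
      ((r * Real.cos t : ℝ) + (s * Real.sin t : ℝ) * Complex.I)).re +
      d * (z₀ + Complex.exp (φ * Complex.I) *
      ((r * Real.cos t : ℝ) + (s * Real.sin t : ℝ) * Complex.I)).im =
      c * z₀.re + d * z₀.im + (P * Real.cos t + Q * Real.sin t) := by
    intro t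
    simp only [Complex.add_re, Complex.add_im, Complex.mul_re, Complex.mul_im,
      Complex.exp_ofReal_mul_I_re, Complex.exp_ofReal_mul_I_im, Complex.ofReal_re,
      Complex.ofReal_im, Complex.I_re, Complex.I_im, hP, hQ]
    ring
  constructor
  · have hn : ‖(⟨P, Q⟩ : ℂ)‖ = √(P ^ 2 + Q ^ 2) := by
      rw [Complex.norm_def, Complex.normSq_mk, sq, sq]
    have h1 := Complex.norm_mul_cos_arg ⟨P, Q⟩
    have h2 := Complex.norm_mul_sin_arg ⟨P, Q⟩
    refine ⟨_, ⟨Complex.arg ⟨P, Q⟩, rfl⟩, ?_⟩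
    simp only [val]
    rw [hn] at h1 h2
    have h3 := Real.sin_sq_add_cos_sq (Complex.arg ⟨P, Q⟩)
    simp only at h1 h2
    rw [add_right_inj]
    linear_combination -Real.cos (Complex.arg ⟨P, Q⟩) * h1 - Real.sin (Complex.arg ⟨P, Q⟩) * h2
      + √(P ^ 2 + Q ^ 2) * h3
  · rintro _ ⟨_, ⟨t, rfl⟩, rfl⟩
    simp only [val]
    gcongr
    refine Real.le_sqrt_of_sq_le ?_
    nlinarith [sq_nonneg (P * Real.sin t - Q * Real.cos t), Real.sin_sq_add_cos_sq t,
      sq_nonneg P, sq_nonneg Q]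

theorem isGreatest_image_convexHull_union {E₁ E₂ : Set ℂ} {c d M₁ M₂ : ℝ}
    (h₁ : IsGreatest ((fun z : ℂ => c * z.re + d * z.im) '' E₁) M₁)
    (h₂ : IsGreatest ((fun z : ℂ => c * z.re + d * z.im) '' E₂) M₂) :
    IsGreatest ((fun z : ℂ => c * z.re + d * z.im) '' convexHull ℝ (E₁ ∪ E₂)) (max M₁ M₂) := by
  have hu := h₁.union h₂
  rw [← Set.image_union] at hu
  refine ⟨Set.image_mono (subset_convexHull ℝ _) hu.1, ?_⟩
  have hlin : IsLinearMap ℝ (fun z : ℂ => c * z.re + d * z.im) :=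
    ⟨fun z w => by simp only [Complex.add_re, Complex.add_im]; ring, fun a z => by
      simp only [Complex.smul_re, Complex.smul_im, smul_eq_mul]; ring⟩
  rintro _ ⟨z, hz, rfl⟩
  exact convexHull_min (fun w hw => hu.2 ⟨w, hw, rfl⟩) (convex_halfSpace_le hlin _) hz

/-! ### The support function of `W(A_b)` in coordinates -/

open ComplexConjugate in
theorem norm_sq_mul_conj_sub_mul_I (c s : ℝ) (z : ℂ) : ‖c * conj z - s * Complex.I‖ ^ 2 =
    c ^ 2 * (z.re ^ 2 + z.im ^ 2) + 2 * c * s * z.im + s ^ 2 := by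
  rw [Complex.sq_norm, Complex.normSq_apply]
  simp
  ring

open ComplexConjugate in
/-- The support function of the numerical range in the direction `c + i s`, away from degenerate directions. -/
theorem numericalRange_triangularizedMatrix_support (α b₁ b₂ : ℂ) {b c s : ℝ} (hcb : c * b ≠ 0)
    (hm : c ^ 2 * (b₂.re ^ 2 + b₂.im ^ 2) + 2 * c * s * b₂.im + s ^ 2 ≠ 0) :
    IsGreatest ((fun z : ℂ => c * z.re + s * z.im) ''
      numericalRange (triangularizedMatrix α b₁ b₂ b))
      √((c * α.re + s * α.im) ^ 2 + ((c ^ 2 * (b₁.re ^ 2 + b₁.im ^ 2 + (b₂.re ^ 2 + b₂.im ^ 2) +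
        b ^ 2) + 2 * c * s * (b₁.im + b₂.im) + 2 * s ^ 2) / 2 +
        |c| * √(((c * (b₁.re ^ 2 + b₁.im ^ 2 - (b₂.re ^ 2 + b₂.im ^ 2) + b ^ 2) +
          2 * s * (b₁.im - b₂.im)) / 2) ^ 2 +
          b ^ 2 * (c ^ 2 * (b₂.re ^ 2 + b₂.im ^ 2) + 2 * c * s * b₂.im + s ^ 2)))) := by
  have e₁ := norm_sq_mul_conj_sub_mul_I c s b₁
  have e₂ := norm_sq_mul_conj_sub_mul_I c s b₂
  have hn₂ : 0 ≤ c ^ 2 * (b₂.re ^ 2 + b₂.im ^ 2) + 2 * c * s * b₂.im + s ^ 2 := by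
    rw [← e₂]; positivity
  -- `D` is half the gap between the eigenvalues of `M*M`. The difference of the diagonal entries
  -- and the off-diagonal entries are divisible by `c`; the factor `|c|` pulled out is the source of
  -- the kink.
  set D := |c| * √(((c * (b₁.re ^ 2 + b₁.im ^ 2 - (b₂.re ^ 2 + b₂.im ^ 2) + b ^ 2) +
          2 * s * (b₁.im - b₂.im)) / 2) ^ 2 +
          b ^ 2 * (c ^ 2 * (b₂.re ^ 2 + b₂.im ^ 2) + 2 * c * s * b₂.im + s ^ 2)) with hD
  have hD0 : 0 ≤ D := by positivity
  have hDsq : D ^ 2 = c ^ 2 * (((c * (b₁.re ^ 2 + b₁.im ^ 2 - (b₂.re ^ 2 + b₂.im ^ 2) + b ^ 2) +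
          2 * s * (b₁.im - b₂.im)) / 2) ^ 2 +
          b ^ 2 * (c ^ 2 * (b₂.re ^ 2 + b₂.im ^ 2) + 2 * c * s * b₂.im + s ^ 2)) := by
    rw [hD, mul_pow, sq_abs, Real.sq_sqrt (by positivity)]
  clear_value D
  have habs : |c * (c * (b₁.re ^ 2 + b₁.im ^ 2 - (b₂.re ^ 2 + b₂.im ^ 2) + b ^ 2) +
          2 * s * (b₁.im - b₂.im)) / 2| ≤ D := by
    refine abs_le_of_sq_le_sq ?_ hD0
    rw [hDsq]
    nlinarith [mul_nonneg (mul_nonneg (sq_nonneg c) (sq_nonneg b)) hn₂]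
  have := abs_le.1 habs
  apply numericalRange_triangularizedMatrix_isGreatest _ _ _ _ _ _ _ hcb
  · intro h
    rw [h] at e₂
    simp at e₂
    exact hm (by simpa using e₂.symm)
  · rw [e₁, e₂]
    linear_combination hDsq
  · rw [e₁]
    linarith
  · rw [e₂]
    linarith

/-! ### Comparison of the support functions and conclusion -/

/-- Normalizing directions to `±(t, 1)` makes the contributions of the centers affine in `t` and the
radicands quadratic; distinct centers give distinct affine functions. -/
theorem IsBiElliptical.exists_support {S : Set ℂ} (h : IsBiElliptical S) :
    ∃ p₁ q₁ p₂ q₂ r₁ s₁ u₁ r₂ s₂ u₂ : ℝ, ¬ (p₁ = p₂ ∧ q₁ = q₂) ∧ 0 < r₁ ∧ 0 < r₂ ∧ ∀ t : ℝ,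
      IsGreatest ((fun z : ℂ => t * z.re + 1 * z.im) '' S)
        (max (q₁ + p₁ * t + √(r₁ + s₁ * t + u₁ * t ^ 2))
          (q₂ + p₂ * t + √(r₂ + s₂ * t + u₂ * t ^ 2))) ∧
      IsGreatest ((fun z : ℂ => -t * z.re + -1 * z.im) '' S)
        (max (-(q₁ + p₁ * t) + √(r₁ + s₁ * t + u₁ * t ^ 2))
          (-(q₂ + p₂ * t) + √(r₂ + s₂ * t + u₂ * t ^ 2))) := by
  obtain ⟨_, _, z₁, z₂, ⟨r₁, s₁, φ₁, hr₁, hs₁, rfl⟩, ⟨r₂, s₂, φ₂, hr₂, hs₂, rfl⟩, hz, -, -, rfl⟩ := h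
  have pos : ∀ r s φ : ℝ, 0 < r → 0 < s →
      0 < r ^ 2 * Real.sin φ ^ 2 + s ^ 2 * Real.cos φ ^ 2 := by
    intro r s φ hr hs
    by_cases hc : Real.cos φ = 0
    · have := Real.sin_sq_add_cos_sq φ
      rw [hc] at this ⊢
      have : Real.sin φ ^ 2 = 1 := by linarith
      rw [this]
      positivity
    · positivity
  refine ⟨z₁.re, z₁.im, z₂.re, z₂.im, _, 2 * Real.sin φ₁ * Real.cos φ₁ * (r₁ ^ 2 - s₁ ^ 2),
    r₁ ^ 2 * Real.cos φ₁ ^ 2 + s₁ ^ 2 * Real.sin φ₁ ^ 2, _,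
    2 * Real.sin φ₂ * Real.cos φ₂ * (r₂ ^ 2 - s₂ ^ 2),
    r₂ ^ 2 * Real.cos φ₂ ^ 2 + s₂ ^ 2 * Real.sin φ₂ ^ 2, fun h => hz (Complex.ext h.1 h.2),
    pos r₁ s₁ φ₁ hr₁ hs₁, pos r₂ s₂ φ₂ hr₂ hs₂, fun t => ⟨?_, ?_⟩⟩
  · convert isGreatest_image_convexHull_union (isGreatest_image_ellipse z₁ r₁ s₁ φ₁ t 1)
      (isGreatest_image_ellipse z₂ r₂ s₂ φ₂ t 1) using 3 <;> ring_nf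
  · convert isGreatest_image_convexHull_union (isGreatest_image_ellipse z₁ r₁ s₁ φ₁ (-t) (-1))
      (isGreatest_image_ellipse z₂ r₂ s₂ φ₂ (-t) (-1)) using 4 <;> ring_nf

theorem IsBiElliptical.coefficients {α b₁ b₂ : ℂ} {b : ℝ} (hb : 0 < b)
    (h : IsBiElliptical (numericalRange (triangularizedMatrix α b₁ b₂ b))) :
    ∃ κ : ℝ, 0 < κ ∧ 4 * κ * (α.im ^ 2 + 1) = (b₁.im - b₂.im) ^ 2 + b ^ 2 ∧
      4 * κ * (2 * α.re * α.im + (b₁.im + b₂.im)) =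
        (b₁.re ^ 2 + b₁.im ^ 2 - (b₂.re ^ 2 + b₂.im ^ 2) + b ^ 2) * (b₁.im - b₂.im) +
          2 * b ^ 2 * b₂.im ∧
      4 * κ * (α.re ^ 2 + (b₁.re ^ 2 + b₁.im ^ 2 + (b₂.re ^ 2 + b₂.im ^ 2) + b ^ 2) / 2) =
        4 * κ ^ 2 + ((b₁.re ^ 2 + b₁.im ^ 2 - (b₂.re ^ 2 + b₂.im ^ 2) + b ^ 2) ^ 2 / 4 +
          b ^ 2 * (b₂.re ^ 2 + b₂.im ^ 2)) := by
  obtain ⟨p₁, q₁, p₂, q₂, r₁, s₁, u₁, r₂, s₂, u₂, hL, hR₁, hR₂, hS⟩ := h.exists_support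
  -- The eigenvector in the support formula may vanish at `t = 0`, so the comparison uses a
  -- punctured neighbourhood.
  have hne : ∀ᶠ t in 𝓝[≠] (0 : ℝ), t * b ≠ 0 ∧
      t ^ 2 * (b₂.re ^ 2 + b₂.im ^ 2) + 2 * t * b₂.im + 1 ≠ 0 := by
    have hc : ContinuousAt (fun t : ℝ => t ^ 2 * (b₂.re ^ 2 + b₂.im ^ 2) + 2 * t * b₂.im + 1) 0 := by
      fun_prop
    have := hc.eventually_ne (y := 0) (by norm_num)
    filter_upwards [this.filter_mono nhdsWithin_le_nhds, self_mem_nhdsWithin] with t ht ht0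
    exact ⟨mul_ne_zero ht0 hb.ne', ht⟩
  refine coefficients_of_kink (s₁ := s₁) (u₁ := u₁) (s₂ := s₂) (u₂ := u₂) hL hR₁ hR₂ (by positivity) (by positivity) ?_ ?_
  · filter_upwards [hne] with t ht
    rw [(hS t).1.unique (numericalRange_triangularizedMatrix_support α b₁ b₂ ht.1
      (by simpa using ht.2))]
    congr 1
    rw [← add_assoc]
    congr 1
    · ring
    · congr 2
      ring
  · filter_upwards [hne] with t ht
    rw [(hS t).2.unique (numericalRange_triangularizedMatrix_support α b₁ b₂ (c := -t) (s := -1)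
      (by simpa using ht.1) (by simpa using ht.2)), abs_neg]
    congr 1
    rw [← add_assoc]
    congr 1
    · ring
    · congr 2
      ring

theorem corollary4p3 (α b₁ b₂ : ℂ) (hα : α ≠ 0) (b b' : ℝ) (hb : 0 < b) (hb' : 0 < b')
    (h : IsBiElliptical (numericalRange (triangularizedMatrix α b₁ b₂ b)))
    (h' : IsBiElliptical (numericalRange (triangularizedMatrix α b₁ b₂ b'))) :
    b = b' := by
  obtain ⟨κ, hκ, h0, h1, h2⟩ := h.coefficients hb
  obtain ⟨κ', hκ', h0', h1', h2'⟩ := h'.coefficients hb'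
  have := sq_unique (a₁ := α.re) (a₂ := α.im) (x₁ := b₁.re) (y₁ := b₁.im) (x₂ := b₂.re)
    (y₂ := b₂.im) (β := b ^ 2) (β' := b' ^ 2) (m := 4 * κ) (m' := 4 * κ')
    (fun h => hα (Complex.ext h.1 h.2)) (by positivity) (by positivity) (by positivity)
    (by positivity) h0 h1 (by linear_combination 4 * h2) h0' h1' (by linear_combination 4 * h2')
  exact (pow_left_inj₀ hb.le hb'.le two_ne_zero).1 this
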